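/- Formulas of propositional modal logic are built from countably many variables with $\top,\neg,\wedge,\Box$; write $\Diamond\varphi=\neg\Box\neg\varphi$, $\Box^*\varphi=\varphi\wedge\Box\varphi$, $\varphi\to\psi=\neg(\varphi\wedge\neg\psi)$. For $n\ge 0$ let $\mathbb{P}_n(\varphi_0,\dots,\varphi_n)=\Diamond(\varphi_1\wedge\Diamond(\varphi_2\wedge\cdots\wedge\Diamond(\varphi_n\wedge\Diamond\varphi_0)\cdots))$, with $\mathbb{P}_0(\varphi_0)=\Diamond\varphi_0$, and $\mathbb{D}_n(\varphi_0,\dots,\varphi_n)=\bigwedge_{i<j\le n}\neg(\varphi_i\wedge\varphi_j)$, with $\mathbb{D}_0=\top$. Let $\mathrm{K4}\mathbb{C}_n$ be the smallest normal modal logic that includes all formulas $\Box\varphi\to\Box\Box\varphi$ and all formulas $\Box^*\mathbb{D}_n(\varphi_0,\dots,\varphi_n)\to(\Diamond\varphi_0\to\Diamond(\varphi_0\wedge\neg\mathbb{P}_n(\varphi_0,\dots,\varphi_n)))$. A normal modal algebra is a (possibly one-element) Boolean algebra with a unary operation, interpreting $\Box$, that preserves finite meets, including the empty meet $1$; a formula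 is valid in it if it takes the value $1$ under every assignment of elements to its variables. Let $\mathcal{V}_n$ be the class of all normal modal algebras that validate every theorem of $\mathrm{K4}\mathbb{C}_n$. A frame is a (possibly empty) set $W$ with a binary relation $R$. A cycle of length $m\ge 1$ is a sequence of distinct points $x_0,\dots,x_{m-1}$ with $x_0R\cdots Rx_{m-1}Rx_0$, and the circumference of the frame is the supremum of the lengths of its cycles ($0$ if there are none). The complex algebra $(W,R)^+$ is the power set Boolean algebra of $W$ with the operation $X\mapsto\{x:\forall y\,(xRy\Rightarrow y\in X)\}$. Let $\mathscr{C}_n^+$ be the class of complex algebras of all finite transitive frames of circumference at most $n$. Let $\mathbf{H},\mathbf{S},\mathbf{P},\mathbf{P}_U$ denote the class operations of taking homomorphic images, isomorphic copies of subalgebras, of direct products, and of ultraproducts, respectively. **Theorem.** For every $n\ge 0$, $$\mathcal{V}_n=\mathbf{H}\mathbf{S}\mathbf{P}\,\mathscr{C}_n^+=\mathbf{S}\mathbf{P}_U\,\mathscr{C}_n^+ .$$ Thus $\mathcal{V}_n$ is the variety generated by $\mathscr{C}_n^+$, that is, the smallest class that contains $\mathscr{C}_n^+$ and is closed under $\mathbf{H}$,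 $\mathbf{S}$ and $\mathbf{P}$, and its members are exactly the algebras embeddable into ultraproducts of members of $\mathscr{C}_n^+$. Moreover, $\mathcal{V}_n$ is the class of all algebras (in the signature $\top,\neg,\wedge,\Box$) that satisfy every universal sentence satisfied by all members of $\mathscr{C}_n^+$. -/

import Mathlib

universe u v w

namespace ModalCirc

open FirstOrder CategoryTheory

/-! ### Modal formulas and the logic `K4ℂ_n` -/

/-- Propositional modal formulas over a denumerable set of variables. -/
inductive Formula : Type
  | var : ℕ → Formula
  | top : Formula
  | neg : Formula → Formula
  | and : Formula → Formula → Formula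
  | box : Formula → Formula

namespace Formula

/-- `φ → ψ`. -/
def imp (φ ψ : Formula) : Formula := neg (and φ (neg ψ))

/-- `◇φ = ¬□¬φ`. -/
def dia (φ : Formula) : Formula := neg (box (neg φ))

/-- `□*φ = φ ∧ □φ`. -/
def boxStar (φ : Formula) : Formula := and φ (box φ)

/-- Conjunction of a finite list of formulas; the empty conjunction is `⊤`. -/
def conj (l : List Formula) : Formula := l.foldr and top

/-- `pathAux φ₀ [φ₁, …, φₙ] = ◇(φ₁ ∧ ◇(φ₂ ∧ ⋯ ∧ ◇(φₙ ∧ ◇φ₀)⋯))`, and `◇φ₀` for the empty list. -/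
def pathAux (φ₀ : Formula) : List Formula → Formula
  | [] => dia φ₀
  | ψ :: l => dia (and ψ (pathAux φ₀ l))

/-- The formula `ℙ_n(φ₀, …, φₙ)`. -/
def P (n : ℕ) (φ : Fin (n + 1) → Formula) : Formula :=
  pathAux (φ 0) (List.ofFn fun i : Fin n => φ i.succ)

/-- The formula `𝔻_n(φ₀, …, φₙ) = ⋀_{i<j≤n} ¬(φᵢ ∧ φⱼ)`. -/
def D (n : ℕ) (φ : Fin (n + 1) → Formula) : Formula :=
  conj (((List.finRange (n + 1) ×ˢ List.finRange (n + 1)).filter fun p => p.1 < p.2).map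
    fun p => neg (and (φ p.1) (φ p.2)))

/-- The formula `□*𝔻_n → (◇φ₀ → ◇(φ₀ ∧ ¬ℙ_n))`. -/
def C (n : ℕ) (φ : Fin (n + 1) → Formula) : Formula :=
  imp (boxStar (D n φ)) (imp (dia (φ 0)) (dia (and (φ 0) (neg (P n φ)))))

/-- A tautology is true under every assignment of truth values to formulas that respects the
Boolean connectives (variables and formulas `□ψ` being assigned arbitrary values). -/
def IsTautology (φ : Formula) : Prop :=
  ∀ e : Formula → Prop, e top → (∀ ψ, e (neg ψ) ↔ ¬ e ψ) →
    (∀ ψ χ, e (and ψ χ) ↔ (e ψ ∧ e χ)) → e φ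

end Formula

open Formula

/-- Normal logics: sets of formulas containing all tautologies and all instances of K, closed under
modus ponens and `□`-generalisation. -/
structure IsNormalLogic (Λ : Set Formula) : Prop where
  taut : ∀ φ, IsTautology φ → φ ∈ Λ
  axiomK : ∀ φ ψ, imp (box (imp φ ψ)) (imp (box φ) (box ψ)) ∈ Λ
  mp : ∀ φ ψ, imp φ ψ ∈ Λ → φ ∈ Λ → ψ ∈ Λ
  gen : ∀ φ, φ ∈ Λ → box φ ∈ Λ

/-- The scheme 4: all formulas `□φ → □□φ`. -/
def scheme4 : Set Formula := {χ | ∃ φ, χ = imp (box φ) (box (box φ))}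

/-- The scheme `ℂ_n`. -/
def schemeC (n : ℕ) : Set Formula := {χ | ∃ φ : Fin (n + 1) → Formula, χ = C n φ}

/-- `K4ℂ_n`, the smallest normal logic that includes the schemes 4 and `ℂ_n`. -/
def K4C (n : ℕ) : Set Formula :=
  ⋂₀ {Λ | IsNormalLogic Λ ∧ scheme4 ⊆ Λ ∧ schemeC n ⊆ Λ}

/-! ### The algebraic language of modal algebras -/

/-- Function symbols `⊤`, `¬`, `∧`, `□` with their arities. -/
inductive ModalFunc : ℕ → Type
  | top : ModalFunc 0
  | neg : ModalFunc 1
  | and : ModalFunc 2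
  | box : ModalFunc 1

/-- The first-order language of modal algebras; it has no relation symbols besides equality. -/
def modalLang : FirstOrder.Language.{0, 0} := ⟨ModalFunc, fun _ => Empty⟩

section Operations

variable {A : Type u} [modalLang.Structure A]

/-- The constant `⊤` of an algebra of the modal language. -/
def opTop (A : Type u) [modalLang.Structure A] : A :=
  Language.Structure.funMap (L := modalLang) (n := 0) ModalFunc.top ![]

/-- The interpretation of `¬`. -/
def opNeg (a : A) : A := Language.Structure.funMap (L := modalLang) (n := 1) ModalFunc.neg ![a]

/-- The interpretation of `∧`. -/
def opAnd (a b : A) : A :=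
  Language.Structure.funMap (L := modalLang) (n := 2) ModalFunc.and ![a, b]

/-- The interpretation of `□`. -/
def opBox (a : A) : A := Language.Structure.funMap (L := modalLang) (n := 1) ModalFunc.box ![a]

/-- The value in `A` of a formula under an assignment of elements of `A` to the variables. -/
def Formula.value (v : ℕ → A) : Formula → A
  | .var i => v i
  | .top => opTop A
  | .neg φ => opNeg (φ.value v)
  | .and φ ψ => opAnd (φ.value v) (ψ.value v)
  | .box φ => opBox (φ.value v)

end Operations

/-- `φ` is valid in `A`: the equation `φ ≈ ⊤` is satisfied in `A`. -/
def Valid (A : Type u) [modalLang.Structure A] (φ : Formula) : Prop :=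
  ∀ v : ℕ → A, φ.value v = opTop A

/-- `A` is a normal modal algebra: `⊤, ¬, ∧` are the unit, complement and meet of a Boolean
algebra (possibly with one element), and `□` preserves finite meets, including the empty one. -/
def IsNormalModalAlgebra (A : Type u) [modalLang.Structure A] : Prop :=
  ∃ _ : BooleanAlgebra A,
    opTop A = ⊤ ∧ (∀ a : A, opNeg a = aᶜ) ∧ (∀ a b : A, opAnd a b = a ⊓ b) ∧
    opBox (⊤ : A) = ⊤ ∧ ∀ a b : A, opBox (a ⊓ b) = opBox a ⊓ opBox b

/-- The class `V_n` of all normal modal algebras that validate all theorems of `K4ℂ_n`. -/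
def V (n : ℕ) : Set (Bundled.{u} modalLang.Structure) :=
  {A | IsNormalModalAlgebra A ∧ ∀ φ ∈ K4C n, Valid A φ}

/-! ### Frames, circumference and complex algebras -/

/-- A cycle of length `k + 1`: distinct points `x₀, …, x_k` with `x₀ R x₁ R ⋯ R x_k R x₀`
(addition in `Fin (k + 1)` is modulo `k + 1`). -/
def IsCycle {W : Type u} (R : W → W → Prop) {k : ℕ} (x : Fin (k + 1) → W) : Prop :=
  Function.Injective x ∧ ∀ i, R (x i) (x (i + 1))

/-- The circumference: the supremum of the lengths of all cycles (`0` if there are none). -/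
noncomputable def circumference {W : Type u} (R : W → W → Prop) : ℕ∞ :=
  sSup {l | ∃ (k : ℕ) (x : Fin (k + 1) → W), IsCycle R x ∧ l = ((k + 1 : ℕ) : ℕ∞)}

/-- The operations of the complex algebra of the frame `(W, R)`, on the power set of `W`:
Boolean set operations, and `[R]X = {x | ∀ y, x R y → y ∈ X}`. -/
@[reducible] def complexStructure {W : Type u} (R : W → W → Prop) : modalLang.Structure (Set W) where
  funMap := fun {k} (f : ModalFunc k) =>
    match k, f with
    | _, .top => fun _ => Set.univ
    | _, .neg => fun X => (X 0)ᶜ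
    | _, .and => fun X => X 0 ∩ X 1
    | _, .box => fun X => {x | ∀ y, R x y → y ∈ X 0}
  RelMap := fun {_} (r : Empty) => r.elim

/-- The complex algebra `(W, R)⁺`. -/
def complexAlgebra {W : Type u} (R : W → W → Prop) : Bundled.{u} modalLang.Structure :=
  ⟨Set W, complexStructure R⟩

/-- The class `𝒞_n⁺` of complex algebras of finite transitive frames of circumference at most
`n`. -/
def CPlus (n : ℕ) : Set (Bundled.{u} modalLang.Structure) :=
  {A | ∃ (W : Type u) (R : W → W → Prop),
    Finite W ∧ (∀ x y z, R x y → R y z → R x z) ∧ circumference R ≤ (n : ℕ∞) ∧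
      A = complexAlgebra R}

/-! ### Class operations -/

section ClassOperations

variable {L : FirstOrder.Language.{v, w}}

/-- The pointwise structure on a direct product. -/
@[reducible] def piStructure {I : Type u} (B : I → Bundled.{u} L.Structure) : L.Structure (∀ i, B i) where
  funMap := fun f x i => Language.Structure.funMap f fun j => x j i
  RelMap := fun r x => ∀ i, Language.Structure.RelMap r fun j => x j i

/-- The direct product of a family of structures. -/
def prod {I : Type u} (B : I → Bundled.{u} L.Structure) : Bundled.{u} L.Structure :=
  ⟨∀ i, B i, piStructure B⟩

/-- The ultraproduct of a family of structures. -/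
def ultraprod {I : Type u} (U : Ultrafilter I) (B : I → Bundled.{u} L.Structure) :
    Bundled.{u} L.Structure :=
  ⟨(U : Filter I).Product fun i => B i, Language.Ultraproduct.structure (L := L)⟩

/-- Homomorphic images of members of `K`. -/
def opH (K : Set (Bundled.{u} L.Structure)) : Set (Bundled.{u} L.Structure) :=
  {A | ∃ B ∈ K, ∃ f : B →[L] A, Function.Surjective f}

/-- Isomorphic copies of substructures of members of `K`. -/
def opS (K : Set (Bundled.{u} L.Structure)) : Set (Bundled.{u} L.Structure) :=
  {A | ∃ B ∈ K, ∃ S : L.Substructure B, Nonempty (A ≃[L] S)}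

/-- Isomorphic copies of direct products of members of `K`. -/
def opP (K : Set (Bundled.{u} L.Structure)) : Set (Bundled.{u} L.Structure) :=
  {A | ∃ (I : Type u) (B : I → Bundled.{u} L.Structure),
    (∀ i, B i ∈ K) ∧ Nonempty (A ≃[L] prod B)}

/-- Isomorphic copies of ultraproducts of members of `K`. -/
def opPU (K : Set (Bundled.{u} L.Structure)) : Set (Bundled.{u} L.Structure) :=
  {A | ∃ (I : Type u) (U : Ultrafilter I) (B : I → Bundled.{u} L.Structure),
    (∀ i, B i ∈ K) ∧ Nonempty (A ≃[L] ultraprod U B)}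

/-- A variety: a class closed under homomorphic images, subalgebras and direct products. -/
def IsVariety (K : Set (Bundled.{u} L.Structure)) : Prop :=
  opH K ⊆ K ∧ opS K ⊆ K ∧ opP K ⊆ K

/-- The universal theory of `K`: all universal sentences satisfied by every member of `K`. -/
def universalTheory (K : Set (Bundled.{u} L.Structure)) : L.Theory :=
  {σ | σ.IsUniversal ∧ ∀ A ∈ K, A ⊨ σ}

/-- The class of all models of the theory `T`. -/
def models (T : L.Theory) : Set (Bundled.{u} L.Structure) := {A | A ⊨ T}

end ClassOperations

end ModalCirc

/-! The inclusions `V n` ⊆ SP_U ⊆ HSP ⊆ `V n` give the equalities of classes. The last holds because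
`V n` is equational and contains `CPlus n` (`mem_truthSet_C`); the middle one because an
ultraproduct is a quotient of a product and SH ⊆ HS. The universal theory lies between: universal
sentences pass to SP_U by Łoś's theorem, and the equations of `V n` are themselves universal
sentences.

The substance is the first inclusion. By `exists_finite_frame`, each finite part F of an algebra in
`V n` is represented in a member of `CPlus n`; an ultraproduct over all F then glues these maps into
an embedding. The frame for F is the transitive filtration on the nonzero cells generated by F and
□F. Its clusters may be too large, so inside each cluster only the arrows into a core of at most n
cells are kept. `exists_small_subset` extracts this core from the scheme ℂ_n, and
`Cells.exists_thin` shows that thinning loses no witness for a false □a. -/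

namespace ModalCirc

open FirstOrder CategoryTheory

/-! ### Boolean algebras with a normal operation -/

section Boolean

variable {A : Type u} [BooleanAlgebra A]

/-- The operation `□` preserves finite meets. -/
structure IsNormalBox (box : A → A) : Prop where
  top : box ⊤ = ⊤
  inf : ∀ a b, box (a ⊓ b) = box a ⊓ box b

/-- The operation `◇` dual to `□`. -/
def diaOp (box : A → A) (a : A) : A := (box aᶜ)ᶜ

/-- `◇(a₁ ⊓ ◇(a₂ ⊓ ⋯ ⊓ ◇(aₙ ⊓ ◇a₀)⋯))`. -/
def pathOp (box : A → A) (a₀ : A) : List A → A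
  | [] => diaOp box a₀
  | a :: l => diaOp box (a ⊓ pathOp box a₀ l)

theorem IsNormalBox.mono {box : A → A} (hb : IsNormalBox box) : Monotone box := fun x y hxy => by
  have := hb.inf x y
  rw [inf_eq_left.2 hxy] at this
  exact inf_eq_left.1 this.symm

/-- Normality gives □¬(a ∧ v) ∧ □v ≤ □¬a: a part that sees a, and sees only v, sees a ∧ v. -/
theorem le_diaOp_inf_of_le_box {box : A → A} (hb : IsNormalBox box) {u a v : A}
    (h : u ≤ diaOp box a) (h' : u ≤ box v) : u ≤ diaOp box (a ⊓ v) := by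
  have key : box (a ⊓ v)ᶜ ⊓ box v ≤ box aᶜ := by
    rw [← hb.inf]
    apply hb.mono
    rw [compl_inf, inf_sup_right, compl_inf_self, sup_bot_eq]
    exact inf_le_left
  have h1 : u ⊓ box (a ⊓ v)ᶜ ≤ ⊥ := by
    calc u ⊓ box (a ⊓ v)ᶜ ≤ diaOp box a ⊓ box aᶜ :=
          le_inf (inf_le_left.trans h)
            ((le_inf inf_le_right (inf_le_left.trans h')).trans key)
      _ = ⊥ := compl_inf_self _
  exact le_compl_iff_disjoint_right.2 (disjoint_iff_inf_le.2 h1)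

theorem IsNormalBox.diaOp_mono {box : A → A} (hb : IsNormalBox box) : Monotone (diaOp box) :=
  fun _ _ hxy => compl_le_compl (hb.mono (compl_le_compl hxy))

theorem IsNormalBox.diaOp_bot {box : A → A} (hb : IsNormalBox box) : diaOp box ⊥ = ⊥ := by
  simp [diaOp, hb.top]

theorem IsNormalBox.finset_inf {box : A → A} (hb : IsNormalBox box) {ι : Type*} (s : Finset ι)
    (f : ι → A) : box (s.inf f) = s.inf fun i => box (f i) := by
  classical
  induction s using Finset.induction_on with
  | empty => simpa using hb.top
  | insert i s hi ih => simp [hb.inf, ih]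

/-- From u every listed a is reachable inside v, and a ∧ v lies in u again, so the walk can always
be continued. -/
theorem le_pathOp {box : A → A} (hb : IsNormalBox box) {u v a₀ : A} {l : List A}
    (hv : u ≤ box v) (h₀ : u ≤ diaOp box a₀) (hl : ∀ a ∈ l, u ≤ diaOp box a ∧ a ⊓ v ≤ u) :
    u ≤ pathOp box a₀ l := by
  induction l with
  | nil => exact h₀
  | cons a l ih =>
    have ha := hl a (by simp)
    have hl' := ih fun b hb => hl b (by simp [hb])
    exact (le_diaOp_inf_of_le_box hb ha.1 hv).trans
      (hb.diaOp_mono (le_inf inf_le_left (ha.2.trans hl')))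

/-- The condition that the scheme `ℂ_n` imposes on disjoint elements. -/
def DisjointPathCondition (box : A → A) (n : ℕ) : Prop :=
  ∀ a : Fin (n + 1) → A, (∀ i j, i < j → Disjoint (a i) (a j)) →
    diaOp box (a 0) ≤ diaOp box (a 0 ⊓ (pathOp box (a 0) (List.ofFn fun i : Fin n => a i.succ))ᶜ)

/-- A family of disjoint elements has at most `n` members that remain possible at a suitable
nonzero part of its join. -/
theorem exists_small_subset {box : A → A} (hb : IsNormalBox box) (h4 : ∀ a, box a ≤ box (box a))
    {n : ℕ} (hC : DisjointPathCondition box n) {ι : Type*} [DecidableEq ι] (m : ι → A)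
    (hm : ∀ i j, i ≠ j → Disjoint (m i) (m j)) (C : Finset ι) (hne : C.sup m ≠ ⊥) :
    ∃ S ⊆ C, S.card ≤ n ∧ C.sup m ⊓ box ((C \ S).sup m)ᶜ ≠ ⊥ := by
  classical
  -- A smallest S is taken; S = C qualifies since □⊤ = ⊤. By minimality, dropping any d from S gives
  -- ⊥, so the nonzero part lies below ◇(m d).
  obtain ⟨S, hS, hmin⟩ := (C.powerset.filter fun S => C.sup m ⊓ box ((C \ S).sup m)ᶜ ≠ ⊥).exists_min_image
    Finset.card ⟨C, by simp [hb.top, hne]⟩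
  simp only [Finset.mem_filter, Finset.mem_powerset] at hS hmin
  refine ⟨S, hS.1, ?_, hS.2⟩
  set v := box ((C \ S).sup m)ᶜ with hv
  have hdia : ∀ d ∈ S, C.sup m ⊓ v ≤ diaOp box (m d) := by
    intro d hd
    by_contra hcon
    have h1 : C.sup m ⊓ box ((C \ (S.erase d)).sup m)ᶜ ≠ ⊥ := by
      intro h0
      apply hcon
      have : C \ (S.erase d) = insert d (C \ S) := by
        ext x
        have := hS.1 hd
        by_cases hx : x = d <;> simp [hx, this]
      rw [this, Finset.sup_insert, compl_sup, hb.inf] at h0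
      exact le_compl_iff_disjoint_right.2 (disjoint_iff.2 (by
        rw [← h0, hv, inf_assoc, inf_comm (box _) (box _)]))
    have h2 := hmin _ ⟨(Finset.erase_subset _ _).trans hS.1, h1⟩
    have h3 := Finset.card_erase_lt_of_mem hd
    omega
  by_contra hcard
  push Not at hcard
  -- With n + 1 members available, the nonzero part lies below their path element. As `a 0 ⊓ v` lies
  -- in that part, the point of `a 0` without a path that ℂ_n promises cannot exist inside v.
  obtain ⟨t, ht, htc⟩ := Finset.exists_subset_card_eq (Nat.succ_le_of_lt hcard)
  let e : Fin (n + 1) ≃ t := (Finset.equivFinOfCardEq htc).symm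
  let a : Fin (n + 1) → A := fun i => m (e i)
  have hea : ∀ i, C.sup m ⊓ v ≤ diaOp box (a i) := fun i => hdia _ (ht (e i).2)
  have hle : ∀ i, a i ⊓ v ≤ C.sup m ⊓ v := fun i =>
    inf_le_inf_right _ (Finset.le_sup (f := m) (hS.1 (ht (e i).2)))
  have hd := hC a fun i j hij => hm _ _ fun h => hij.ne (e.injective (Subtype.ext h))
  have hvv : C.sup m ⊓ v ≤ box v := inf_le_right.trans (h4 _)
  have hp : C.sup m ⊓ v ≤ pathOp box (a 0) (List.ofFn fun i : Fin n => a i.succ) := by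
    refine le_pathOp hb hvv (hea 0) ?_
    intro b hb'
    rw [List.mem_ofFn] at hb'
    obtain ⟨i, rfl⟩ := hb'
    exact ⟨hea _, hle _⟩
  have hfin := le_diaOp_inf_of_le_box hb ((hea 0).trans hd) hvv
  apply hS.2
  rw [eq_bot_iff, ← hb.diaOp_bot]
  refine hfin.trans (hb.diaOp_mono ?_)
  rw [inf_right_comm]
  calc _ ≤ (C.sup m ⊓ v) ⊓ (pathOp box (a 0) (List.ofFn fun i : Fin n => a i.succ))ᶜ :=
        inf_le_inf_right _ (hle 0)
    _ ≤ _ := inf_le_inf_right _ hp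
    _ = ⊥ := inf_compl_self _

/-! ### Finite partitions -/

/-- The meet of the members of `T` and of the complements of the other members of `G`. -/
def cell [DecidableEq A] (G T : Finset A) : A := T.inf id ⊓ (G \ T).inf compl

variable [DecidableEq A]

theorem cell_le {G T : Finset A} {a : A} (h : a ∈ T) : cell G T ≤ a :=
  inf_le_left.trans (Finset.inf_le (f := id) h)

theorem cell_le_compl {G T : Finset A} {a : A} (hG : a ∈ G) (h : a ∉ T) : cell G T ≤ aᶜ :=
  inf_le_right.trans (Finset.inf_le (f := compl) (Finset.mem_sdiff.2 ⟨hG, h⟩))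

theorem disjoint_cell {G S T : Finset A} (hS : S ⊆ G) (hT : T ⊆ G) (h : S ≠ T) :
    Disjoint (cell G S) (cell G T) := by
  by_contra hcon
  apply h
  ext a
  constructor
  · intro ha
    by_contra ha'
    exact hcon (disjoint_compl_right.mono (cell_le ha) (cell_le_compl (hS ha) ha'))
  · intro ha
    by_contra ha'
    exact hcon (disjoint_compl_left.mono (cell_le_compl (hT ha) ha') (cell_le ha))

/-- A nonzero element stays nonzero on meeting a or its complement, one generator a at a time. -/
theorem exists_cell_inf_ne_bot (G : Finset A) {x : A} (hx : x ≠ ⊥) :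
    ∃ T ⊆ G, x ⊓ cell G T ≠ ⊥ := by
  induction G using Finset.induction_on generalizing x with
  | empty => exact ⟨∅, by simp, by simpa [cell] using hx⟩
  | insert a G ha ih =>
    by_cases h : x ⊓ a = ⊥
    · obtain ⟨T, hT, hne⟩ := ih hx
      refine ⟨T, hT.trans (Finset.subset_insert _ _), ?_⟩
      have haT : a ∉ T := fun h => ha (hT h)
      rw [cell, Finset.insert_sdiff_of_notMem _ haT, Finset.inf_insert]
      have hxa : x ≤ aᶜ := le_compl_iff_disjoint_right.2 (disjoint_iff.2 h)
      rw [cell] at hne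
      rwa [inf_left_comm (T.inf id), ← inf_assoc, inf_eq_left.2 hxa]
    · obtain ⟨T, hT, hne⟩ := ih h
      refine ⟨insert a T, Finset.insert_subset_insert _ hT, ?_⟩
      have : insert a G \ insert a T = G \ T := by
        ext b
        by_cases hb : b = a
        · simp [hb, ha]
        · simp [hb]
      rw [cell, this, Finset.inf_insert, id, inf_assoc, ← inf_assoc]
      exact hne

end Boolean

/-! ### The finite frame of cells -/

section CellFrame

variable {A : Type u} [BooleanAlgebra A] [DecidableEq A] (box : A → A) (F : Finset A)

/-- The nonzero cells of the partition generated by the elements `a` and `□a`, for `a ∈ F`. -/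
def Cells : Type u := {T : Finset A // T ⊆ F ∪ F.image box ∧ cell (F ∪ F.image box) T ≠ ⊥}

namespace Cells

variable {box F}

/-- The element of the algebra given by a cell. -/
def elt (T : Cells box F) : A := cell (F ∪ F.image box) T.1

theorem elt_ne_bot (T : Cells box F) : T.elt ≠ ⊥ := T.2.2

instance : Finite (Cells box F) :=
  Finite.of_injective (β := (F ∪ F.image box).powerset)
    (fun T => ⟨T.1, Finset.mem_powerset.2 T.2.1⟩) fun S T h => Subtype.ext (by simpa using h)

noncomputable instance : Fintype (Cells box F) := Fintype.ofFinite _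

noncomputable instance : DecidableEq (Cells box F) := Classical.decEq _

theorem disjoint_elt {S T : Cells box F} (h : S ≠ T) : Disjoint S.elt T.elt :=
  disjoint_cell S.2.1 T.2.1 fun h' => h (Subtype.ext h')

theorem elt_le_or (T : Cells box F) {a : A} (h : a ∈ F ∪ F.image box) :
    T.elt ≤ a ∨ T.elt ≤ aᶜ := by
  by_cases ha : a ∈ T.1
  · exact Or.inl (cell_le ha)
  · exact Or.inr (cell_le_compl h ha)

theorem elt_le_compl_iff (T : Cells box F) {a : A} (h : a ∈ F ∪ F.image box) :
    T.elt ≤ aᶜ ↔ ¬ T.elt ≤ a :=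
  ⟨fun h1 h2 => T.elt_ne_bot (by simpa using le_inf h2 h1),
    fun h1 => (T.elt_le_or h).resolve_left h1⟩

theorem le_of_forall_elt {x y : A} (h : ∀ T : Cells box F, x ⊓ T.elt ≤ y) : x ≤ y := by
  by_contra hxy
  obtain ⟨T, hT, hne⟩ := exists_cell_inf_ne_bot (F ∪ F.image box) (x := x ⊓ yᶜ)
    (fun h0 => hxy (by rwa [← disjoint_iff, disjoint_compl_right_iff] at h0))
  have hc : cell (F ∪ F.image box) T ≠ ⊥ := fun h0 => hne (by rw [h0, inf_bot_eq])
  apply hne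
  rw [inf_right_comm, ← disjoint_iff, disjoint_compl_right_iff]
  exact h ⟨T, hT, hc⟩

/-- The transitive filtration. -/
def filt (S T : Cells box F) : Prop := ∀ a ∈ F, S.elt ≤ box a → T.elt ≤ a ⊓ box a

theorem filt_trans {S T U : Cells box F} (h : filt S T) (h' : filt T U) : filt S U :=
  fun a ha hS => h' a ha ((h a ha hS).trans inf_le_right)

/-- Some a ∈ F has S ≤ □a but T ≰ a ∧ □a. Cells decide a and □a, so T is disjoint from a ∧ □a,
whereas U ≤ □a ≤ □(a ∧ □a) by transitivity. -/
theorem elt_le_box_compl {S T U : Cells box F} (hb : IsNormalBox box)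
    (h4 : ∀ a, box a ≤ box (box a)) (h : ¬ filt S T) (hU : U = S ∨ filt S U) :
    U.elt ≤ box T.eltᶜ := by
  simp only [filt, not_forall] at h
  obtain ⟨a, ha, hS, hT⟩ := h
  have hxa : U.elt ≤ box a := by
    rcases hU with rfl | hU
    · exact hS
    · exact (hU a ha hS).trans inf_le_right
  refine (le_inf hxa (hxa.trans (h4 a))).trans ?_
  rw [← hb.inf]
  apply hb.mono
  rw [le_compl_iff_disjoint_left, disjoint_iff]
  by_contra hne
  apply hT
  have h1 : T.elt ≤ a := (T.elt_le_or (by simp [ha])).resolve_right fun h1 =>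
    hne (by rw [← inf_assoc, disjoint_iff.1 (disjoint_compl_left.mono_left h1), bot_inf_eq])
  have h2 : T.elt ≤ box a :=
    (T.elt_le_or (by simp only [Finset.mem_union, Finset.mem_image]; exact Or.inr ⟨a, ha, rfl⟩)
      ).resolve_right fun h2 =>
    hne (by rw [inf_comm a, ← inf_assoc, disjoint_iff.1 (disjoint_compl_left.mono_left h2),
      bot_inf_eq])
  exact le_inf h1 h2

/-- The cells that lie in the same cluster as `T`. -/
noncomputable def cluster (T : Cells box F) : Finset (Cells box F) :=
  letI := Classical.decPred fun U => filt T U ∧ filt U T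
  Finset.univ.filter fun U => filt T U ∧ filt U T

theorem mem_cluster {T U : Cells box F} : U ∈ cluster T ↔ filt T U ∧ filt U T := by
  simp [cluster]

theorem cluster_eq {T U : Cells box F} (h : U ∈ cluster T) : cluster U = cluster T := by
  obtain ⟨h1, h2⟩ := mem_cluster.1 h
  ext V
  rw [mem_cluster, mem_cluster]
  exact ⟨fun h => ⟨filt_trans h1 h.1, filt_trans h.2 h2⟩,
    fun h => ⟨filt_trans h2 h.1, filt_trans h.2 h1⟩⟩

/-- The filtration, thinned out inside each cluster to a subset of it. -/
def thin (core : Finset (Cells box F) → Finset (Cells box F)) (S T : Cells box F) : Prop :=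
  filt S T ∧ (filt T S → T ∈ core (cluster S))

variable {core : Finset (Cells box F) → Finset (Cells box F)}

theorem thin_trans {S T U : Cells box F} (h : thin core S T) (h' : thin core T U) :
    thin core S U := by
  refine ⟨filt_trans h.1 h'.1, fun hUS => ?_⟩
  rw [← cluster_eq (mem_cluster.2 ⟨h.1, filt_trans h'.1 hUS⟩)]
  exact h'.2 (filt_trans hUS h.1)

-- All points of a cycle lie in one cluster, and each is entered by an arrow from within it, hence
-- belongs to the core.
open Fin.NatCast Fin.CommRing in
theorem circumference_thin {n : ℕ} (hcore : ∀ C, (core C).card ≤ n) :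
    circumference (thin core) ≤ (n : ℕ∞) := by
  refine sSup_le ?_
  rintro _ ⟨k, x, ⟨hinj, hx⟩, rfl⟩
  -- The offset is t + 1 because `filt` need not be reflexive; going around the cycle still reaches
  -- every point, including the start.
  have key : ∀ (t : ℕ) (i : Fin (k + 1)), filt (x i) (x (i + (((t : ℕ) : Fin (k + 1)) + 1))) := by
    intro t i
    induction t with
    | zero => simpa using (hx i).1
    | succ t ih =>
      have := filt_trans ih (hx _).1
      rwa [add_assoc, ← Nat.cast_succ] at this
  have hall : ∀ i j, filt (x i) (x j) := by
    intro i j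
    have := key (j - i - 1).val i
    rwa [Fin.cast_val_eq_self, sub_add_cancel, add_sub_cancel] at this
  have hmem : ∀ i, x i ∈ core (cluster (x 0)) := by
    intro i
    have h1 := (hx (i - 1)).2 (hall _ _)
    rw [sub_add_cancel] at h1
    rwa [cluster_eq (mem_cluster.2 ⟨hall 0 (i - 1), hall _ _⟩)] at h1
  have hcard : (Finset.univ.image x).card ≤ n :=
    (Finset.card_le_card (Finset.image_subset_iff.2 fun i _ => hmem i)).trans (hcore _)
  rw [Finset.card_image_of_injective _ hinj, Finset.card_univ, Fintype.card_fin] at hcard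
  exact_mod_cast hcard

/-- Within the cluster of `T`, a sufficiently large core provides the required successors. -/
theorem exists_thin (hb : IsNormalBox box) (h4 : ∀ a, box a ≤ box (box a))
    (hcore : ∀ C : Finset (Cells box F), C.Nonempty →
      C.sup elt ⊓ box ((C \ core C).sup elt)ᶜ ≠ ⊥)
    {T : Cells box F} {a : A} (ha : a ∈ F) (hT : ¬ T.elt ≤ box a) :
    ∃ U, thin core T U ∧ ¬ U.elt ≤ a := by
  by_contra! hcon
  have hbox : box a ∈ F ∪ F.image box := by
    simp only [Finset.mem_union, Finset.mem_image]; exact Or.inr ⟨a, ha, rfl⟩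
  have haG : a ∈ F ∪ F.image box := by simp [ha]
  -- The cells not below a cover ¬a, so a nonzero part of ¬□a cannot exclude all of them from its
  -- successors.
  have main : ∀ x : A, x ≠ ⊥ → x ≤ (box a)ᶜ → ¬ ∀ U : Cells box F, ¬ U.elt ≤ a → x ≤ box U.eltᶜ := by
    classical
    intro x hx0 hx hU
    apply hx0
    have h1 : x ≤ box ((Finset.univ.filter fun U : Cells box F => ¬ U.elt ≤ a).inf
        fun U => U.eltᶜ) := by
      rw [hb.finset_inf, Finset.le_inf_iff]
      simpa using hU
    have h2 : x ≤ box a := by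
      refine h1.trans (hb.mono (le_of_forall_elt (box := box) (F := F) fun U => ?_))
      by_cases h : U.elt ≤ a
      · exact inf_le_right.trans h
      · refine (inf_le_inf_right _ (Finset.inf_le (b := U) (by simpa using h))).trans ?_
        simp
    simpa using le_inf h2 hx
  by_cases hTT : filt T T
  · have hself : T ∈ cluster T := mem_cluster.2 ⟨hTT, hTT⟩
    -- The part used is the one supplied by the core: it lies in the cluster of T, all of which
    -- refutes □a, and sees no cell of the cluster outside the core.
    refine main _ (hcore (cluster T) ⟨T, hself⟩) (inf_le_left.trans (Finset.sup_le ?_)) ?_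
    · intro U hU
      rw [U.elt_le_compl_iff hbox]
      exact fun h => hT (((mem_cluster.1 hU).2 a ha h).trans inf_le_right)
    · intro U hU
      by_cases hTU : filt T U
      · have hnt : ¬ thin core T U := fun h => hU (hcon U h)
        have hUT : filt U T ∧ U ∉ core (cluster T) := by
          simpa [thin, hTU] using hnt
        refine inf_le_right.trans (hb.mono (compl_le_compl (Finset.le_sup (f := elt) ?_)))
        exact Finset.mem_sdiff.2 ⟨mem_cluster.2 ⟨hTU, hUT.1⟩, hUT.2⟩
      · refine inf_le_left.trans (Finset.sup_le fun V hV => ?_)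
        exact elt_le_box_compl hb h4 hTU (Or.inr (mem_cluster.1 hV).1)
  · refine main T.elt T.elt_ne_bot ((T.elt_le_compl_iff hbox).2 hT) fun U hU => ?_
    -- An irreflexive T lies in no cluster, so thinning removes none of its arrows.
    have hTU : ¬ filt T U := fun h =>
      hU (hcon U ⟨h, fun h' => (hTT (filt_trans h h')).elim⟩)
    exact elt_le_box_compl hb h4 hTU (Or.inl rfl)

end Cells

end CellFrame

/-- The finite embeddability property: a finite part of a transitive modal algebra satisfying the
path condition is represented in the complex algebra of a finite transitive frame of bounded
circumference. -/
theorem exists_finite_frame {A : Type u} [BooleanAlgebra A] {box : A → A} (hb : IsNormalBox box)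
    (h4 : ∀ a, box a ≤ box (box a)) {n : ℕ} (hC : DisjointPathCondition box n) (F : Finset A) :
    ∃ (W : Type u) (R : W → W → Prop) (h : A → Set W), Finite W ∧
      (∀ x y z, R x y → R y z → R x z) ∧ circumference R ≤ (n : ℕ∞) ∧ h ⊤ = Set.univ ∧
      (∀ a ∈ F, h aᶜ = (h a)ᶜ) ∧ (∀ a b, h (a ⊓ b) = h a ∩ h b) ∧
      (∀ a ∈ F, h (box a) = {x | ∀ y, R x y → y ∈ h a}) ∧ Set.InjOn h F := by
  classical
  have hex : ∀ C : Finset (Cells box F), ∃ S ⊆ C, S.card ≤ n ∧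
      (C.Nonempty → C.sup Cells.elt ⊓ box ((C \ S).sup Cells.elt)ᶜ ≠ ⊥) := by
    intro C
    by_cases hne : C.Nonempty
    · obtain ⟨S, h1, h2, h3⟩ := exists_small_subset hb h4 hC (Cells.elt (box := box) (F := F))
        (fun _ _ => Cells.disjoint_elt) C (fun h0 => by
          obtain ⟨T, hT⟩ := hne
          exact T.elt_ne_bot (eq_bot_iff.2 (h0 ▸ Finset.le_sup (f := Cells.elt) hT)))
      refine ⟨S, h1, h2, fun _ => ?_⟩
      convert h3
    · exact ⟨∅, by simp, by simp, fun h => (hne h).elim⟩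
  choose core hsub hcard hcore using hex
  refine ⟨Cells box F, Cells.thin core, fun a => {T | T.elt ≤ a}, inferInstance,
    fun _ _ _ => Cells.thin_trans, Cells.circumference_thin hcard, by simp, ?_, ?_, ?_, ?_⟩
  · intro a ha
    ext T
    exact T.elt_le_compl_iff (by simp [ha])
  · intro a b
    ext T
    exact le_inf_iff
  · intro a ha
    ext T
    refine ⟨fun h U hU => (hU.1 a ha h).trans inf_le_left, fun h => ?_⟩
    by_contra hT
    obtain ⟨U, hU, hUa⟩ := Cells.exists_thin hb h4 hcore ha hT
    exact hUa (h U hU)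
  · have key : ∀ a ∈ F, ∀ b : A, {T : Cells box F | T.elt ≤ a} = {T | T.elt ≤ b} → a ≤ b := by
      intro a ha b h
      refine Cells.le_of_forall_elt (box := box) (F := F) fun T => ?_
      rcases T.elt_le_or (a := a) (by simp [ha]) with h1 | h1
      · exact inf_le_right.trans (h.le h1)
      · rw [disjoint_iff.1 (disjoint_compl_right.mono_right h1)]
        exact bot_le
    exact fun a ha b hb' h => le_antisymm (key a ha b h) (key b hb' a h.symm)

/-! ### Values of formulas in normal modal algebras -/

section Values

/-- The operations of `A` are those of the given Boolean algebra and a normal box. -/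
structure IsModalReduct (A : Type u) [modalLang.Structure A] [BooleanAlgebra A] : Prop where
  top : opTop A = ⊤
  neg : ∀ a : A, opNeg a = aᶜ
  and : ∀ a b : A, opAnd a b = a ⊓ b
  box : IsNormalBox (opBox : A → A)

theorem isNormalModalAlgebra_iff {A : Type u} [modalLang.Structure A] :
    IsNormalModalAlgebra A ↔ ∃ _ : BooleanAlgebra A, IsModalReduct A :=
  exists_congr fun _ => ⟨fun ⟨h1, h2, h3, h4, h5⟩ => ⟨h1, h2, h3, h4, h5⟩,
    fun ⟨h1, h2, h3, h4, h5⟩ => ⟨h1, h2, h3, h4, h5⟩⟩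

variable {A : Type u} [modalLang.Structure A] [BooleanAlgebra A]

theorem value_imp_eq_top_iff (hA : IsModalReduct A) (v : ℕ → A) (φ ψ : Formula) :
    (φ.imp ψ).value v = ⊤ ↔ φ.value v ≤ ψ.value v := by
  simp only [Formula.imp, Formula.value, hA.neg, hA.and, compl_eq_top, ← disjoint_iff,
    disjoint_compl_right_iff]

theorem value_dia (hA : IsModalReduct A) (v : ℕ → A) (φ : Formula) :
    φ.dia.value v = diaOp opBox (φ.value v) := by
  simp only [Formula.dia, Formula.value, hA.neg, diaOp]

theorem value_pathAux (hA : IsModalReduct A) (v : ℕ → A) (φ : Formula) (l : List Formula) :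
    (Formula.pathAux φ l).value v =
      pathOp opBox (φ.value v) (l.map fun ψ => ψ.value v) := by
  induction l with
  | nil => exact value_dia hA v φ
  | cons ψ l ih => simp [Formula.pathAux, pathOp, value_dia hA, Formula.value, hA.and, ih]

theorem value_conj_eq_top (hA : IsModalReduct A) (v : ℕ → A) {l : List Formula}
    (h : ∀ ψ ∈ l, ψ.value v = ⊤) : (Formula.conj l).value v = ⊤ := by
  induction l with
  | nil => exact hA.top
  | cons ψ l ih =>
    rw [show Formula.conj (ψ :: l) = ψ.and (Formula.conj l) from rfl, Formula.value, hA.and,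
      h ψ (by simp), ih fun χ hχ => h χ (by simp [hχ]), inf_top_eq]

theorem value_D_eq_top (hA : IsModalReduct A) (v : ℕ → A) {n : ℕ} {φ : Fin (n + 1) → Formula}
    (h : ∀ i j, i < j → Disjoint ((φ i).value v) ((φ j).value v)) :
    (Formula.D n φ).value v = ⊤ := by
  refine value_conj_eq_top hA v fun ψ hψ => ?_
  simp only [List.mem_map, List.mem_filter, decide_eq_true_eq] at hψ
  obtain ⟨p, ⟨-, hp⟩, rfl⟩ := hψ
  rw [Formula.value, Formula.value, hA.neg, hA.and, compl_eq_top, ← disjoint_iff]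
  exact h _ _ hp

theorem box_le_box_box (hA : IsModalReduct A) {n : ℕ} (hV : ∀ φ ∈ K4C n, Valid A φ) (a : A) :
    (opBox a : A) ≤ opBox (opBox a) := by
  have h := hV ((Formula.var 0).box.imp (Formula.var 0).box.box)
    (fun Λ hΛ => hΛ.2.1 ⟨_, rfl⟩) fun _ => a
  rwa [hA.top, value_imp_eq_top_iff hA] at h

/-- Disjointness gives 𝔻_n the value ⊤, hence also □*𝔻_n, and only the consequent of ℂ_n remains. -/
theorem disjointPathCondition (hA : IsModalReduct A) {n : ℕ} (hV : ∀ φ ∈ K4C n, Valid A φ) :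
    DisjointPathCondition (opBox : A → A) n := by
  intro a ha
  let v : ℕ → A := fun i => if h : i < n + 1 then a ⟨i, h⟩ else ⊤
  have hv : ∀ i : Fin (n + 1), (Formula.var i).value v = a i := fun i => by
    exact dif_pos i.2
  have h := hV (Formula.C n fun i => Formula.var i) (fun Λ hΛ => hΛ.2.2 ⟨_, rfl⟩) v
  have hD : (Formula.D n fun i => Formula.var i).value v = ⊤ :=
    value_D_eq_top hA v fun i j hij => by simpa only [hv] using ha i j hij
  have hneg : ∀ φ ψ : Formula, (φ.and ψ.neg).value v = φ.value v ⊓ (ψ.value v)ᶜ := fun φ ψ => by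
    rw [Formula.value, Formula.value, hA.and, hA.neg]
  rw [hA.top, Formula.C, value_imp_eq_top_iff hA, Formula.boxStar, Formula.value, Formula.value,
    hD, hA.and, hA.box.top, inf_top_eq, top_le_iff, value_imp_eq_top_iff hA, value_dia hA,
    value_dia hA, hneg, Formula.P, value_pathAux hA, List.map_ofFn] at h
  have hf : (fun ψ : Formula => ψ.value v) ∘ (fun i : Fin n => Formula.var (i.succ : Fin (n + 1)))
      = fun i => a i.succ := funext fun i => hv i.succ
  rw [hf, hv 0] at h
  exact h

end Values

/-! ### Homomorphisms for the modal language -/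

section Homs

variable {A B : Type u} [modalLang.Structure A] [modalLang.Structure B]

/-- A map that preserves the four operations is a homomorphism. -/
def homOfOps (f : A → B) (htop : f (opTop A) = opTop B) (hneg : ∀ a, f (opNeg a) = opNeg (f a))
    (hand : ∀ a b, f (opAnd a b) = opAnd (f a) (f b))
    (hbox : ∀ a, f (opBox a) = opBox (f a)) : A →[modalLang] B where
  toFun := f
  map_fun' := fun {k} F x => by
    cases F with
    | top =>
      rw [show x = ![] from Subsingleton.elim _ _]
      exact htop.trans (congrArg (Language.Structure.funMap (L := modalLang) (n := 0) ModalFunc.top)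
        (Subsingleton.elim _ _))
    | neg =>
      rw [show x = ![x 0] from funext fun i => by fin_cases i; rfl]
      refine (hneg _).trans (congrArg _ (funext fun i => by fin_cases i; rfl))
    | and =>
      rw [show x = ![x 0, x 1] from funext fun i => by fin_cases i <;> rfl]
      refine (hand _ _).trans (congrArg _ (funext fun i => by fin_cases i <;> rfl))
    | box =>
      rw [show x = ![x 0] from funext fun i => by fin_cases i; rfl]
      refine (hbox _).trans (congrArg _ (funext fun i => by fin_cases i; rfl))
  map_rel' := fun r => Empty.elim r

/-- An injective homomorphism is an embedding, as there are no relation symbols. -/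
def embeddingOfHom (f : A →[modalLang] B) (hf : Function.Injective f) : A ↪[modalLang] B where
  toFun := f
  inj' := hf
  map_fun' := f.map_fun
  map_rel' := fun r => Empty.elim r

theorem map_opTop (f : A →[modalLang] B) : f (opTop A) = opTop B :=
  (f.map_fun _ _).trans (congrArg _ (Subsingleton.elim _ _))

theorem map_opNeg (f : A →[modalLang] B) (a : A) : f (opNeg a) = opNeg (f a) :=
  (f.map_fun _ _).trans (congrArg _ (funext fun i => by fin_cases i; rfl))

theorem map_opAnd (f : A →[modalLang] B) (a b : A) : f (opAnd a b) = opAnd (f a) (f b) :=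
  (f.map_fun _ _).trans (congrArg _ (funext fun i => by fin_cases i <;> rfl))

theorem map_opBox (f : A →[modalLang] B) (a : A) : f (opBox a) = opBox (f a) :=
  (f.map_fun _ _).trans (congrArg _ (funext fun i => by fin_cases i; rfl))

theorem map_value (f : A →[modalLang] B) (v : ℕ → A) (φ : Formula) :
    f (φ.value v) = φ.value (fun i => f (v i)) := by
  induction φ with
  | var i => rfl
  | top => exact map_opTop f
  | neg φ ih => rw [Formula.value, map_opNeg, ih]; rfl
  | and φ ψ ih ih' => rw [Formula.value, map_opAnd, ih, ih']; rfl
  | box φ ih => rw [Formula.value, map_opBox, ih]; rfl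

end Homs

/-! ### Class operations -/

section Classes

variable {L : FirstOrder.Language.{v, w}} {K K' : Set (Bundled.{u} L.Structure)}

theorem opH_mono (h : K ⊆ K') : opH K ⊆ opH K' := fun _ ⟨B, hB, f⟩ => ⟨B, h hB, f⟩

theorem opS_mono (h : K ⊆ K') : opS K ⊆ opS K' := fun _ ⟨B, hB, f⟩ => ⟨B, h hB, f⟩

theorem opP_mono (h : K ⊆ K') : opP K ⊆ opP K' := fun _ ⟨I, B, hB, f⟩ => ⟨I, B, fun i => h (hB i), f⟩

/-- The quotient map from a direct product to an ultraproduct. -/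
def prodToUltraprod {I : Type u} (U : Ultrafilter I) (B : I → Bundled.{u} L.Structure) :
    prod B →[L] ultraprod U B where
  toFun := fun x => Quotient.mk'' x
  map_fun' := fun f x =>
    (Language.Ultraproduct.funMap_cast (L := L) (u := U) (M := fun i => B i) f x).symm
  map_rel' := fun r x h => by
    let := Language.Ultraproduct.setoidPrestructure (L := L) (fun i => B i) U
    exact (Language.relMap_quotient_mk' (L := L) (s := (U : Filter I).productSetoid fun i => B i) r x).2
      (Filter.Eventually.of_forall h)

theorem opPU_subset_opH_opP : opPU K ⊆ opH (opP K) := by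
  rintro A ⟨I, U, B, hB, ⟨e⟩⟩
  refine ⟨prod B, ⟨I, B, hB, ⟨Language.Equiv.refl _ _⟩⟩,
    e.symm.toHom.comp (prodToUltraprod U B), ?_⟩
  exact e.symm.surjective.comp Quotient.mk''_surjective

/-- A substructure of an image is the image of its preimage. -/
theorem opS_opH_subset_opH_opS : opS (opH K) ⊆ opH (opS K) := by
  rintro A ⟨C, ⟨B, hB, f, hf⟩, S, ⟨e⟩⟩
  let g : S.comap f →[L] S :=
    Language.Hom.codRestrict S (f.comp (S.comap f).subtype.toHom) fun c => c.2
  refine ⟨⟨S.comap f, inferInstance⟩, ⟨B, hB, S.comap f, ⟨Language.Equiv.refl _ _⟩⟩,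
    e.symm.toHom.comp g, ?_⟩
  refine e.symm.surjective.comp ?_
  rintro ⟨c, hc⟩
  obtain ⟨b, rfl⟩ := hf c
  exact ⟨⟨b, hc⟩, rfl⟩

theorem mem_opS_of_embedding {A B : Bundled.{u} L.Structure} (hB : B ∈ K) (f : A ↪[L] B) :
    A ∈ opS K :=
  ⟨B, hB, f.toHom.range, ⟨f.equivRange⟩⟩

theorem exists_embedding_of_mem_opS {A : Bundled.{u} L.Structure} (hA : A ∈ opS K) :
    ∃ B ∈ K, Nonempty (A ↪[L] B) := by
  obtain ⟨B, hB, S, ⟨e⟩⟩ := hA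
  exact ⟨B, hB, ⟨S.subtype.comp e.toEmbedding⟩⟩

theorem IsVariety.opH_opS_opP_subset (hK' : IsVariety K') (h : K ⊆ K') :
    opH (opS (opP K)) ⊆ K' :=
  (opH_mono ((opS_mono ((opP_mono h).trans hK'.2.2)).trans hK'.2.1)).trans hK'.1

theorem opS_opPU_subset : opS (opPU K) ⊆ opH (opS (opP K)) :=
  (opS_mono opPU_subset_opH_opP).trans opS_opH_subset_opH_opS

end Classes

/-! ### Embedding into an ultraproduct of finite complex algebras -/

theorem mem_opS_opPU_of_mem_V {n : ℕ} {A : Bundled.{u} modalLang.Structure} (h : A ∈ V.{u} n) :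
    A ∈ opS (opPU (CPlus.{u} n)) := by
  obtain ⟨hA, hV⟩ := h
  obtain ⟨_, hA⟩ := isNormalModalAlgebra_iff.1 hA
  choose W R h hfin htrans hcirc htop hcompl hinf hbox hinj using
    exists_finite_frame hA.box (box_le_box_box hA hV) (disjointPathCondition hA hV)
  let B : Finset A → Bundled.{u} modalLang.Structure := fun F => complexAlgebra (R F)
  -- Refining `atTop` puts each a in U-almost every F, so properties of `h F` that hold only on F
  -- become exact in the ultraproduct.
  let U : Ultrafilter (Finset A) := Ultrafilter.of Filter.atTop
  have hU : ∀ s ∈ (Filter.atTop : Filter (Finset A)), s ∈ U := fun s hs => Ultrafilter.of_le _ hs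
  have hmem : ∀ a : A, ∀ᶠ F : Finset A in (U : Filter (Finset A)), a ∈ F := fun a =>
    hU _ ((Filter.eventually_ge_atTop {a}).mono fun F hF => hF (Finset.mem_singleton_self a))
  let q := prodToUltraprod U B
  have hq : ∀ x y : ∀ F, B F, (∀ᶠ F in U, x F = y F) → q x = q y := fun x y hxy =>
    Quotient.sound hxy
  let g : A → prod B := fun a F => h F a
  let f : A →[modalLang] ultraprod U B := homOfOps (fun a => q (g a))
    (by
      rw [← map_opTop q]
      exact hq _ _ (Filter.Eventually.of_forall fun F => (congrArg (h F) hA.top).trans (htop F)))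
    (fun a => by
      rw [← map_opNeg q]
      exact hq _ _ ((hmem a).mono fun F hF => (congrArg (h F) (hA.neg a)).trans (hcompl F a hF)))
    (fun a b => by
      rw [← map_opAnd q]
      exact hq _ _ (Filter.Eventually.of_forall fun F =>
        (congrArg (h F) (hA.and a b)).trans (hinf F a b)))
    (fun a => by
      rw [← map_opBox q]
      exact hq _ _ ((hmem a).mono fun F hF => hbox F a hF))
  refine mem_opS_of_embedding (B := ultraprod U B)
    ⟨_, U, B, fun F => ⟨W F, R F, hfin F, htrans F, hcirc F, rfl⟩, ⟨Language.Equiv.refl _ _⟩⟩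
    (embeddingOfHom f fun a b hab => ?_)
  have hab' : ∀ᶠ F in U, g a F = g b F := Quotient.exact hab
  obtain ⟨F, ⟨hFa, hFb⟩, hF⟩ := (((hmem a).and (hmem b)).and hab').exists
  exact hinj F hFa hFb hF

/-! ### Soundness for finite transitive frames of bounded circumference -/

section Soundness

variable {W : Type u} (R : W → W → Prop)

/-- The set of points of the frame `(W, R)` at which a formula is true. -/
def truthSet (v : ℕ → Set W) (φ : Formula) : Set W :=
  letI := complexStructure R
  φ.value v

variable {R} {v : ℕ → Set W} {x : W}

theorem mem_truthSet_top : x ∈ truthSet R v .top := trivial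

theorem mem_truthSet_neg {φ : Formula} : x ∈ truthSet R v φ.neg ↔ x ∉ truthSet R v φ := Iff.rfl

theorem mem_truthSet_and {φ ψ : Formula} :
    x ∈ truthSet R v (φ.and ψ) ↔ x ∈ truthSet R v φ ∧ x ∈ truthSet R v ψ := Iff.rfl

theorem mem_truthSet_box {φ : Formula} :
    x ∈ truthSet R v φ.box ↔ ∀ y, R x y → y ∈ truthSet R v φ := Iff.rfl

theorem mem_truthSet_imp {φ ψ : Formula} :
    x ∈ truthSet R v (φ.imp ψ) ↔ (x ∈ truthSet R v φ → x ∈ truthSet R v ψ) := by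
  simp [Formula.imp, mem_truthSet_neg, mem_truthSet_and]

theorem mem_truthSet_dia {φ : Formula} :
    x ∈ truthSet R v φ.dia ↔ ∃ y, R x y ∧ y ∈ truthSet R v φ := by
  simp [Formula.dia, mem_truthSet_neg, mem_truthSet_box]

theorem mem_truthSet_conj {l : List Formula} :
    x ∈ truthSet R v (Formula.conj l) ↔ ∀ ψ ∈ l, x ∈ truthSet R v ψ := by
  induction l with
  | nil => exact ⟨fun _ _ h => by simp at h, fun _ => mem_truthSet_top⟩
  | cons ψ l ih =>
    rw [show Formula.conj (ψ :: l) = ψ.and (Formula.conj l) from rfl, mem_truthSet_and, ih]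
    simp

theorem mem_truthSet_D {n : ℕ} {φ : Fin (n + 1) → Formula} (h : x ∈ truthSet R v (Formula.D n φ))
    {i j : Fin (n + 1)} (hi : x ∈ truthSet R v (φ i)) (hj : x ∈ truthSet R v (φ j)) : i = j := by
  rw [Formula.D, mem_truthSet_conj] at h
  have key : ∀ i j, i < j → ¬ (x ∈ truthSet R v (φ i) ∧ x ∈ truthSet R v (φ j)) :=
    fun i j hij => h ((φ i).and (φ j)).neg (List.mem_map.2 ⟨(i, j), by simpa using hij, rfl⟩)
  rcases lt_trichotomy i j with hij | hij | hij
  · exact (key _ _ hij ⟨hi, hj⟩).elim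
  · exact hij
  · exact (key _ _ hij ⟨hj, hi⟩).elim

theorem exists_path {φ : Formula} {l : List Formula} (h : x ∈ truthSet R v (Formula.pathAux φ l)) :
    ∃ y : ℕ → W, y 0 = x ∧ (∀ i ≤ l.length, R (y i) (y (i + 1))) ∧
      (∀ (i : ℕ) (hi : i < l.length), y (i + 1) ∈ truthSet R v l[i]) ∧
      y (l.length + 1) ∈ truthSet R v φ := by
  induction l generalizing x with
  | nil =>
    obtain ⟨y, hy, hφ⟩ := mem_truthSet_dia.1 h
    exact ⟨fun i => if i = 0 then x else y, by simp, by simpa using hy, by simp, by simpa using hφ⟩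
  | cons ψ l ih =>
    obtain ⟨z, hz, hzψl⟩ := mem_truthSet_dia.1 h
    obtain ⟨hzψ, hzl⟩ := mem_truthSet_and.1 hzψl
    obtain ⟨y, h0, h1, h2, h3⟩ := ih hzl
    refine ⟨fun i => i.casesOn x y, rfl, ?_, ?_, h3⟩
    · rintro (_ | i) hi
      · simpa [h0] using hz
      · exact h1 i (by simpa using hi)
    · rintro (_ | i) hi
      · simpa [h0] using hzψ
      · exact h2 i (by simpa using hi)

/-- If ℂ_n failed at x, a path for ℙ_n from a final φ₀-successor z of x would return to z, closing a
cycle of n + 1 points that 𝔻_n makes distinct. -/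
theorem mem_truthSet_C [Finite W] (htrans : ∀ x y z, R x y → R y z → R x z) {n : ℕ}
    (hcirc : circumference R ≤ (n : ℕ∞)) (φ : Fin (n + 1) → Formula) :
    x ∈ truthSet R v (Formula.C n φ) := by
  rw [Formula.C, mem_truthSet_imp, mem_truthSet_imp, mem_truthSet_dia, mem_truthSet_dia]
  rintro ⟨-, hD⟩ hex
  by_contra! hcon
  let r : W → W → Prop := fun a b => R b a ∧ ¬ R a b
  have : IsTrans W r := ⟨fun a b c hab hbc =>
    ⟨htrans _ _ _ hbc.1 hab.1, fun hac => hab.2 (htrans _ _ _ hac hbc.1)⟩⟩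
  have : Std.Irrefl r := ⟨fun a h => h.2 h.1⟩
  -- Minimality for `r` means that every φ₀-successor of x seen from z sees z back.
  obtain ⟨z, ⟨hxz, hz0⟩, hmax⟩ := (Finite.wellFounded_of_trans_of_irrefl r).has_min
    {y | R x y ∧ y ∈ truthSet R v (φ 0)} hex
  have hP : z ∈ truthSet R v (Formula.P n φ) := by
    have := hcon z hxz
    rw [mem_truthSet_and, mem_truthSet_neg] at this
    tauto
  obtain ⟨y, h0, h1, h2, h3⟩ := exists_path hP
  simp only [List.length_ofFn, List.getElem_ofFn] at h1 h2 h3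
  have hy : ∀ i : Fin (n + 1), y i ∈ truthSet R v (φ i) := by
    intro i
    refine Fin.cases ?_ (fun j => ?_) i
    · simpa [h0] using hz0
    · exact h2 j j.2
  have hzy : ∀ i ≤ n, R z (y (i + 1)) := by
    intro i
    induction i with
    | zero => exact fun hi => h0 ▸ h1 0 hi
    | succ i ih => exact fun hi => htrans _ _ _ (ih (by omega)) (h1 _ hi)
  have hxy : ∀ i ≤ n, R x (y i) := by
    rintro (_ | i) hi
    · rwa [h0]
    · exact htrans _ _ _ hxz (hzy i (by omega))
  have hback : R (y (n + 1)) z := by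
    by_contra hn
    exact hmax _ ⟨htrans _ _ _ hxz (hzy n le_rfl), h3⟩ ⟨hzy n le_rfl, hn⟩
  -- The endpoint `y (n + 1)` is left out, as it may repeat an earlier point; transitivity through
  -- it gives the closing arrow from `y n` to z.
  have hcyc : IsCycle R fun i : Fin (n + 1) => y i := by
    refine ⟨fun i j hij => ?_, fun i => ?_⟩
    · have hij : y i = y j := hij
      exact mem_truthSet_D (hD _ (hxy i (Nat.lt_succ_iff.1 i.2))) (hy i) (hij ▸ hy j)
    · by_cases hi : i = Fin.last n
      · subst hi
        simpa [h0] using htrans _ _ _ (h1 n le_rfl) hback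
      · have hlt : i < Fin.last n := lt_of_le_of_ne (Fin.le_last i) hi
        simp only [Fin.val_add_one_of_lt hlt]
        exact h1 i (Nat.lt_succ_iff.1 i.2)
  have hlen : ((n + 1 : ℕ) : ℕ∞) ≤ circumference R := le_sSup ⟨n, _, hcyc, rfl⟩
  have hle : ((n + 1 : ℕ) : ℕ∞) ≤ n := hlen.trans hcirc
  exact absurd (Nat.cast_le.1 hle) (by omega)

/-- As `K4C n` is the least logic of its kind, soundness reduces to this and the validity of the two
schemes. -/
theorem isNormalLogic_validities (R : W → W → Prop) :
    IsNormalLogic {φ | ∀ (v : ℕ → Set W) (x : W), x ∈ truthSet R v φ} where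
  taut := fun φ hφ v x => hφ (fun ψ => x ∈ truthSet R v ψ) mem_truthSet_top
    (fun _ => mem_truthSet_neg) fun _ _ => mem_truthSet_and
  axiomK := fun φ ψ v x => by
    simp only [mem_truthSet_imp, mem_truthSet_box]
    exact fun h1 h2 y hy => h1 y hy (h2 y hy)
  mp := fun φ ψ h1 h2 v x => mem_truthSet_imp.1 (h1 v x) (h2 v x)
  gen := fun φ h v x y _ => h v y

theorem CPlus_subset_V (n : ℕ) : CPlus.{u} n ⊆ V.{u} n := by
  rintro _ ⟨W, R, hfin, htrans, hcirc, rfl⟩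
  refine ⟨⟨inferInstanceAs (BooleanAlgebra (Set W)), rfl, fun _ => rfl, fun _ _ => rfl, ?_, ?_⟩, ?_⟩
  · exact Set.eq_univ_of_forall fun x y _ => trivial
  · intro a b
    refine Set.ext fun x => ?_
    exact ⟨fun h => ⟨fun y hy => (h y hy).1, fun y hy => (h y hy).2⟩,
      fun h y hy => ⟨h.1 y hy, h.2 y hy⟩⟩
  · intro φ hφ v
    refine Set.eq_univ_of_forall (hφ _ ⟨isNormalLogic_validities R, ?_, ?_⟩ v)
    · rintro _ ⟨φ, rfl⟩ v x
      simp only [mem_truthSet_imp, mem_truthSet_box]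
      exact fun h y hy z hz => h z (htrans _ _ _ hy hz)
    · rintro _ ⟨φ, rfl⟩ v x
      exact mem_truthSet_C htrans hcirc φ

end Soundness

/-! ### The classes `V n` are equational -/

/-- The equation `p.1 ≈ p.2` is satisfied in `A`. -/
def SatisfiesEq (A : Type u) [modalLang.Structure A] (p : Formula × Formula) : Prop :=
  ∀ v : ℕ → A, p.1.value v = p.2.value v

/-- The class of algebras that satisfy a set of equations. -/
def eqClass (E : Set (Formula × Formula)) : Set (Bundled.{u} modalLang.Structure) :=
  {A | ∀ p ∈ E, SatisfiesEq A p}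

theorem isVariety_eqClass (E : Set (Formula × Formula)) : IsVariety (eqClass.{u} E) := by
  refine ⟨?_, ?_, ?_⟩
  · rintro A ⟨B, hB, f, hf⟩ p hp v
    choose w hw using fun i => hf (v i)
    obtain rfl : (fun i => f (w i)) = v := funext hw
    rw [← map_value f w, ← map_value f w, hB p hp]
  · intro A hA p hp v
    obtain ⟨B, hB, ⟨f⟩⟩ := exists_embedding_of_mem_opS hA
    apply f.injective
    have h := hB p hp fun i => f.toHom (v i)
    rwa [← map_value, ← map_value] at h
  · rintro A ⟨I, B, hB, ⟨e⟩⟩ p hp v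
    apply e.injective
    funext i
    let π : prod B →[modalLang] B i := ⟨fun x => x i, fun _ _ => rfl, fun _ _ h => h i⟩
    have h := hB i p hp fun j => (π.comp e.toHom) (v j)
    rwa [← map_value, ← map_value] at h

/-- Equations that define normal modal algebras. -/
def normalModalEqs : Set (Formula × Formula) :=
  let x := Formula.var 0
  let y := Formula.var 1
  let z := Formula.var 2
  let or := fun φ ψ : Formula => (φ.neg.and ψ.neg).neg
  {(x.and y, y.and x), ((x.and y).and z, x.and (y.and z)), (x.neg.neg, x),
    (x.and (or x y), x), (x.and (or y z), or (x.and y) (x.and z)), (x.and .top, x),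
    (x.and x.neg, .neg .top), (.box .top, .top), ((x.and y).box, x.box.and y.box)}

/-- Join is defined by De Morgan, so double negation yields the dual lattice laws from those for
meet. -/
theorem isNormalModalAlgebra_of_ops {A : Type u} [modalLang.Structure A]
    (hcomm : ∀ a b : A, opAnd a b = opAnd b a)
    (hassoc : ∀ a b c : A, opAnd (opAnd a b) c = opAnd a (opAnd b c))
    (hneg : ∀ a : A, opNeg (opNeg a) = a)
    (habs : ∀ a b : A, opAnd a (opNeg (opAnd (opNeg a) (opNeg b))) = a)
    (hdist : ∀ a b c : A, opAnd a (opNeg (opAnd (opNeg b) (opNeg c))) =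
      opNeg (opAnd (opNeg (opAnd a b)) (opNeg (opAnd a c))))
    (htop : ∀ a : A, opAnd a (opTop A) = a)
    (hbot : ∀ a : A, opAnd a (opNeg a) = opNeg (opTop A))
    (hboxtop : opBox (opTop A) = opTop A)
    (hbox : ∀ a b : A, opBox (opAnd a b) = opAnd (opBox a) (opBox b)) :
    IsNormalModalAlgebra A := by
  let : Max A := ⟨fun a b => opNeg (opAnd (opNeg a) (opNeg b))⟩
  let : Min A := ⟨opAnd⟩
  have hsup : ∀ a b : A, a ⊔ b = opNeg (opAnd (opNeg a) (opNeg b)) := fun _ _ => rfl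
  have hinf : ∀ a b : A, a ⊓ b = opAnd a b := fun _ _ => rfl
  let L : Lattice A := Lattice.mk'
    (fun a b => by rw [hsup, hcomm]; rfl)
    (fun a b c => by simp only [hsup, hneg, hassoc])
    hcomm hassoc
    (fun a b => by
      have := habs (opNeg a) (opNeg b)
      rw [hneg, hneg] at this
      rw [hsup, hinf, this, hneg])
    habs
  have hle : ∀ a b : A, a ⊓ b = a → a ≤ b := fun a b => inf_eq_left.1
  let D : DistribLattice A := DistribLattice.ofInfSupLe fun a b c => (hdist a b c).le
  let B : BooleanAlgebra A :=
    { D with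
      compl := opNeg
      top := opTop A
      bot := opNeg (opTop A)
      inf_compl_le_bot := fun a => (hbot a).le
      top_le_sup_compl := fun a => by
        have : a ⊔ opNeg a = opTop A := by
          rw [hsup, hneg, hcomm, hbot, hneg]
        exact this.ge
      le_top := fun a => hle _ _ (htop a)
      bot_le := fun a => by
        refine hle _ _ ?_
        rw [hinf, ← hbot a, hassoc, hcomm (opNeg a) a, ← hassoc]
        exact congrArg (opAnd · (opNeg a)) (inf_idem a) }
  exact ⟨B, rfl, fun _ => rfl, fun _ _ => rfl, hboxtop, hbox⟩

theorem satisfiesEq_normalModalEqs {A : Type u} [modalLang.Structure A] :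
    (∀ p ∈ normalModalEqs, SatisfiesEq A p) ↔ IsNormalModalAlgebra A := by
  constructor
  · intro h
    simp only [normalModalEqs, Set.mem_insert_iff, Set.mem_singleton_iff, forall_eq_or_imp,
      forall_eq, SatisfiesEq, Formula.value] at h
    obtain ⟨h1, h2, h3, h4, h5, h6, h7, h8, h9⟩ := h
    let w : A → A → A → ℕ → A := fun a b c i => if i = 0 then a else if i = 1 then b else c
    exact isNormalModalAlgebra_of_ops (fun a b => h1 (w a b b)) (fun a b c => h2 (w a b c))
      (fun a => h3 (w a a a)) (fun a b => h4 (w a b b)) (fun a b c => h5 (w a b c))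
      (fun a => h6 (w a a a)) (fun a => h7 (w a a a)) (h8 fun _ => opTop A)
      (fun a b => h9 (w a b b))
  · intro h
    obtain ⟨_, hA⟩ := isNormalModalAlgebra_iff.1 h
    simp only [normalModalEqs, Set.mem_insert_iff, Set.mem_singleton_iff, forall_eq_or_imp,
      forall_eq, SatisfiesEq, Formula.value, hA.neg, hA.and, hA.top, hA.box.top, hA.box.inf]
    refine ⟨fun v => inf_comm _ _, fun v => inf_assoc _ _ _, fun v => compl_compl _, ?_, ?_, ?_,
      ?_, ?_, ?_⟩ <;> intro v <;> simp [inf_sup_left]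

/-- Equations that define `V n`. -/
def eqsV (n : ℕ) : Set (Formula × Formula) :=
  normalModalEqs ∪ {p | p.1 ∈ K4C n ∧ p.2 = .top}

theorem V_eq_eqClass (n : ℕ) : V.{u} n = eqClass.{u} (eqsV n) := by
  ext A
  constructor
  · rintro ⟨h1, h2⟩ p (hp | ⟨hp, hp'⟩)
    · exact satisfiesEq_normalModalEqs.2 h1 p hp
    · intro v
      rw [hp']
      exact h2 _ hp v
  · intro h
    exact ⟨satisfiesEq_normalModalEqs.1 fun p hp => h p (Or.inl hp),
      fun φ hφ v => h (φ, .top) (Or.inr ⟨hφ, rfl⟩) v⟩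

/-! ### Universal sentences -/

/-- The term that corresponds to a formula, its variables being taken modulo `k + 1`. -/
def Formula.toTerm (k : ℕ) : Formula → modalLang.Term (Empty ⊕ Fin (k + 1))
  | .var i => .var (Sum.inr (Fin.ofNat (k + 1) i))
  | .top => .func (L := modalLang) (l := 0) ModalFunc.top ![]
  | .neg φ => .func (L := modalLang) (l := 1) ModalFunc.neg ![φ.toTerm k]
  | .and φ ψ => .func (L := modalLang) (l := 2) ModalFunc.and ![φ.toTerm k, ψ.toTerm k]
  | .box φ => .func (L := modalLang) (l := 1) ModalFunc.box ![φ.toTerm k]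

/-- A bound for the variables of a formula. -/
def Formula.bound : Formula → ℕ
  | .var i => i
  | .top => 0
  | .neg φ => φ.bound
  | .and φ ψ => max φ.bound ψ.bound
  | .box φ => φ.bound

section Terms

variable {A : Type u} [modalLang.Structure A]

/-- The bound makes the reduction modulo k + 1 vacuous. -/
theorem realize_toTerm (k : ℕ) (v : ℕ → A) (φ : Formula) (hφ : φ.bound ≤ k) :
    (φ.toTerm k).realize (Sum.elim Empty.elim fun i : Fin (k + 1) => v i) = φ.value v := by
  induction φ with
  | var i =>
    exact congrArg v (Nat.mod_eq_of_lt (Nat.lt_succ_of_le hφ))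
  | top =>
    exact congrArg (Language.Structure.funMap (L := modalLang) (n := 0) ModalFunc.top)
      (Subsingleton.elim _ _)
  | neg φ ih =>
    rw [Formula.value, ← ih hφ]
    exact congrArg _ (funext fun i => by fin_cases i; rfl)
  | and φ ψ ih ih' =>
    rw [Formula.value, ← ih ((le_max_left _ _).trans hφ), ← ih' ((le_max_right _ _).trans hφ)]
    exact congrArg _ (funext fun i => by fin_cases i <;> rfl)
  | box φ ih =>
    rw [Formula.value, ← ih hφ]
    exact congrArg _ (funext fun i => by fin_cases i; rfl)

/-- The universal closure of an equation. -/
def eqSentence (p : Formula × Formula) : modalLang.Sentence :=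
  ((p.1.toTerm (max p.1.bound p.2.bound)).bdEqual (p.2.toTerm (max p.1.bound p.2.bound))).alls

theorem isUniversal_alls {L : FirstOrder.Language.{v, w}} {α : Type*} {k : ℕ}
    {φ : L.BoundedFormula α k} (h : φ.IsUniversal) :
    Language.BoundedFormula.IsUniversal φ.alls := by
  induction k with
  | zero => exact h
  | succ k ih => exact ih h.all

theorem isUniversal_eqSentence (p : Formula × Formula) :
    Language.BoundedFormula.IsUniversal (eqSentence p) :=
  isUniversal_alls (Language.BoundedFormula.IsAtomic.equal _ _).isUniversal

theorem realize_eqSentence (p : Formula × Formula) : A ⊨ eqSentence p ↔ SatisfiesEq A p := by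
  set k := max p.1.bound p.2.bound with hk
  rw [eqSentence, Language.Sentence.Realize,
    Language.BoundedFormula.realize_alls, ← hk]
  simp only [Language.BoundedFormula.realize_bdEqual]
  constructor
  · intro h v
    have := h fun i => v i
    rw [Subsingleton.elim (default : Empty → A) Empty.elim] at this
    rwa [realize_toTerm k v p.1 (le_max_left _ _), realize_toTerm k v p.2 (le_max_right _ _)] at this
  · intro h xs
    obtain ⟨v, rfl⟩ : ∃ v : ℕ → A, xs = fun i : Fin (k + 1) => v i :=
      ⟨fun j => xs (Fin.ofNat (k + 1) j), by funext i; simp⟩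
    rw [Subsingleton.elim (default : Empty → A) Empty.elim,
      realize_toTerm k v p.1 (le_max_left _ _), realize_toTerm k v p.2 (le_max_right _ _)]
    exact h v

end Terms

/-- Łoś's theorem, applied to nonempty factors, carries σ to the ultraproduct; universality carries
it down along the embedding. -/
theorem opS_opPU_subset_models {L : FirstOrder.Language.{v, w}} {K : Set (Bundled.{u} L.Structure)}
    (hK : ∀ B ∈ K, Nonempty B) : opS (opPU K) ⊆ models (universalTheory K) := by
  intro A hA
  obtain ⟨D, ⟨I, U, B, hB, ⟨e⟩⟩, ⟨f⟩⟩ := exists_embedding_of_mem_opS hA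
  refine ⟨fun σ hσ => ?_⟩
  have : ∀ i, Nonempty (B i) := fun i => hK _ (hB i)
  have h : ultraprod U B ⊨ σ := (Language.Ultraproduct.sentence_realize (u := U)
    (M := fun i => B i) σ).2 (Filter.Eventually.of_forall fun i => hσ.2 _ (hB i))
  refine hσ.1.realize_embedding (e.toEmbedding.comp f) ?_
  have h' : Language.BoundedFormula.Realize σ (default : Empty → ultraprod U B) default := h
  convert h'

end ModalCirc


theorem mainTheorem3 (n : ℕ) :
    IsLeast {K | ModalCirc.IsVariety K ∧ ModalCirc.CPlus.{u} n ⊆ K} (ModalCirc.V.{u} n) ∧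
    ModalCirc.V.{u} n = ModalCirc.opH (ModalCirc.opS (ModalCirc.opP (ModalCirc.CPlus.{u} n))) ∧
    ModalCirc.V.{u} n = ModalCirc.opS (ModalCirc.opPU (ModalCirc.CPlus.{u} n)) ∧
    ModalCirc.V.{u} n = ModalCirc.models (ModalCirc.universalTheory (ModalCirc.CPlus.{u} n)) := by
  open ModalCirc in
  have hvar : IsVariety (V.{u} n) := V_eq_eqClass.{u} n ▸ isVariety_eqClass (eqsV n)
  have hSPU : V.{u} n ⊆ opS (opPU (CPlus.{u} n)) := fun A => mem_opS_opPU_of_mem_V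
  have hHSP : opH (opS (opP (CPlus.{u} n))) ⊆ V.{u} n :=
    hvar.opH_opS_opP_subset (CPlus_subset_V n)
  -- Leastness holds since every variety containing `CPlus n` contains its HSP; closure of HSP need
  -- not be proved separately.
  refine ⟨⟨⟨hvar, CPlus_subset_V n⟩, fun K hK =>
    (hSPU.trans opS_opPU_subset).trans (hK.1.opH_opS_opP_subset hK.2)⟩,
    (hSPU.trans opS_opPU_subset).antisymm hHSP, hSPU.antisymm (opS_opPU_subset.trans hHSP),
    (hSPU.trans (opS_opPU_subset_models ?_)).antisymm fun A hA => ?_⟩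
  · rintro _ ⟨W, R, -, -, -, rfl⟩
    -- Even the empty frame has a nonempty complex algebra, with one element.
    exact ⟨(Set.univ : Set W)⟩
  · rw [V_eq_eqClass]
    intro p hp
    refine realize_eqSentence p |>.1 (hA.realize_of_mem _ ⟨isUniversal_eqSentence p, ?_⟩)
    intro B hB
    have h := CPlus_subset_V n hB
    rw [V_eq_eqClass] at h
    exact (realize_eqSentence p).2 (h p hp)
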